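/- For positive integers $n\le m\le n^{3/2}$, let $a_1,\dots,a_m$ be independent, uniformly random vectors in $\{\pm\frac1{\sqrt n}\}^n$. Define the $n^2\times n^2$ matrix $$M=\sum_{i\neq j}\langle a_i,a_j\rangle\,(a_i\otimes a_j)(a_i\otimes a_j)^{T}$$ and the polynomial in $x=(x_1,\dots,x_n)$ $$p(x)=\sum_{i\neq j}\langle a_i,a_j\rangle\,\langle a_i,x\rangle^2\langle a_j,x\rangle^2=(x\otimes x)^TM(x\otimes x),$$ where both sums are over ordered pairs $(i,j)$ with $i \ne j$. For a real number $B$, write $p\preceq_{r,4}B$ if there is a degree-4 sum-of-squares proof of $p(x)\le B$ from the constraint $r(x)=0$, where $r(x)=\|x\|^2-1$; that is, $\deg(B-p)\le 4$ and there are real polynomials $h_1,\dots,h_\ell$ of degree at most $2$ and $g$ with $\deg(rg)\le 4$ such that $$B-p(x)=\sum_{i=1}^{\ell}h_i(x)^2+r(x)g(x).$$ Then there are absolute constants $C>0$ and $k\in\mathbb N$ such that, with high probability, both $$\|M\|\le C(\log n)^k\,\frac{m}{n^{3/2}}\qquad\text{and}\qquad p(x)\preceq_{r,4}C(\log n)^k\,\frac{m}{n^{3/2}},$$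 where $\|M\|$ is the spectral norm. Here high probability means $1-n^{-\omega(1)}$: for every $D\in\mathbb N$ there is $N$ such that for all $n\ge N$ and all $m$ with $n\le m\le n^{3/2}$ the two bounds hold simultaneously with probability at least $1-n^{-D}$. The constants $C$ and $k$ do not depend on $n$, $m$ or $D$. -/

import Mathlib

open scoped BigOperators

noncomputable section

/-- The uniform probability measure on `m × n` arrays of signs (`true` stands for `+`,
`false` for `-`). -/
def signMeasure (m n : ℕ) : MeasureTheory.Measure (Fin m → Fin n → Bool) :=
  (PMF.uniformOfFintype (Fin m → Fin n → Bool)).toMeasure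

/-- The component vectors `a_1, …, a_m ∈ {± 1/√n}^n` given by an array of signs. Under
`signMeasure m n` they are independent and uniform in `{± 1/√n}^n`. -/
def component {m n : ℕ} (s : Fin m → Fin n → Bool) (i : Fin m) : Fin n → ℝ :=
  fun k => if s i k then 1 / √(n : ℝ) else -(1 / √(n : ℝ))

/-- The vector `u ⊗ v` in `ℝ^{n²}`. -/
def tensorVec {n : ℕ} (u v : Fin n → ℝ) : Fin n × Fin n → ℝ :=
  fun q => u q.1 * v q.2

/-- `M = ∑_{i ≠ j} ⟨a_i, a_j⟩ (a_i ⊗ a_j) (a_i ⊗ a_j)ᵀ`, the sum being over ordered pairs. -/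
def crossMatrix {m n : ℕ} (a : Fin m → Fin n → ℝ) :
    Matrix (Fin n × Fin n) (Fin n × Fin n) ℝ :=
  ∑ i, ∑ j ∈ Finset.univ.erase i,
    (a i ⬝ᵥ a j) • Matrix.vecMulVec (tensorVec (a i) (a j)) (tensorVec (a i) (a j))

/-- The spectral norm of a square matrix: the operator norm with respect to Euclidean norms. -/
def matrixSpectralNorm {ι : Type*} [Fintype ι] [DecidableEq ι] (A : Matrix ι ι ℝ) : ℝ :=
  ‖Matrix.toEuclideanCLM (n := ι) (𝕜 := ℝ) A‖

/-- The linear form `⟨u, x⟩` as a polynomial in `x = (x_1, …, x_n)`. -/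
def linearForm {n : ℕ} (u : Fin n → ℝ) : MvPolynomial (Fin n) ℝ :=
  ∑ k, MvPolynomial.C (u k) * MvPolynomial.X k

/-- `p(x) = ∑_{i ≠ j} ⟨a_i, a_j⟩ ⟨a_i, x⟩² ⟨a_j, x⟩²`, the sum being over ordered pairs. -/
def crossPolynomial {m n : ℕ} (a : Fin m → Fin n → ℝ) : MvPolynomial (Fin n) ℝ :=
  ∑ i, ∑ j ∈ Finset.univ.erase i,
    MvPolynomial.C (a i ⬝ᵥ a j) * linearForm (a i) ^ 2 * linearForm (a j) ^ 2

/-- `r(x) = ‖x‖² - 1`, so that `r(x) = 0` says that `x` is a unit vector. -/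
def sphereConstraint (n : ℕ) : MvPolynomial (Fin n) ℝ :=
  ∑ k, MvPolynomial.X k ^ 2 - 1

/-- `p ≼_{R,d} q`: the inequality `p ≤ q` has a sum-of-squares proof of degree `d` from the
constraints `R = {r_1 = 0, …, r_t = 0}`, that is, `q - p = ∑ i, h_i² + ∑ j, r_j g_j` where
`q - p` and all `r_j g_j` have degree at most `d` and all `h_i` have degree at most `d / 2`. -/
def SosLE {n t : ℕ} (r : Fin t → MvPolynomial (Fin n) ℝ) (d : ℕ)
    (p q : MvPolynomial (Fin n) ℝ) : Prop :=
  (q - p).totalDegree ≤ d ∧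
  ∃ (l : ℕ) (h : Fin l → MvPolynomial (Fin n) ℝ) (g : Fin t → MvPolynomial (Fin n) ℝ),
    (∀ i, 2 * (h i).totalDegree ≤ d) ∧
    (∀ j, (r j * g j).totalDegree ≤ d) ∧
    q - p = ∑ i, h i ^ 2 + ∑ j, r j * g j

end

open scoped BigOperators

open Finset Matrix
open scoped Matrix.Norms.L2Operator

/-! The certificate reduces to the spectral bound: if `‖M‖ ≤ B`, then `B·1 - M` is a sum of squares
of linear forms on `ℝ^{n²}`, and evaluating at `x ⊗ x` proves `p ≤ B‖x‖⁴`, which equals `B` modulo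
the sphere constraint (`sosLE_crossPolynomial`).

The spectral bound is a moment estimate resting on the noncommutative Khintchine inequality
(`expect_trace_signedSum_pow_le`): if `∑ Aᵢ² ≼ v`, then `∑ εᵢ Aᵢ` has norm of order `√(p v)` in
`2p`-th moment, up to a dimension factor. To get linear dependence on independent signs, `M` is
decoupled as four times an average, over random sets `I`, of its terms with `i ∈ I`, `j ∉ I`. Each
row `aᵢ` may be multiplied by a random sign without changing its law or its outer product, so only
the coefficient `⟨aᵢ, aⱼ⟩` feels the sign.

Signs on `I` make the cut matrix a Rademacher sum of blocks `aᵢaᵢᵀ ⊗ Sᵢ`, where `Sᵢ = ∑ⱼ ⟨aᵢ, aⱼ⟩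
aⱼaⱼᵀ`, with variance at most `max ‖Sᵢ‖² ‖∑ aᵢaᵢᵀ‖`. Signs off `I` make each `Sᵢ` a Rademacher sum
with variance at most `μ² ‖∑ aⱼaⱼᵀ‖`, `μ` being the coherence. So `‖M‖` is, up to logarithms, at
most `μ ‖∑ aᵢaᵢᵀ‖`. Khintchine again gives `μ ≲ n^{-1/2}` and `‖∑ aᵢaᵢᵀ‖ ≲ m/n`, hence `m/n^{3/2}`.
Moments of order about `log n` and Markov's inequality finish. -/

/-- The sign `±1` encoded by a boolean. -/
def sgn (b : Bool) : ℝ := if b then 1 else -1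

lemma sgn_mul_self (b : Bool) : sgn b * sgn b = 1 := by cases b <;> simp [sgn]

lemma sgn_beq (a b : Bool) : sgn (a == b) = sgn a * sgn b := by
  cases a <;> cases b <;> simp [sgn]

lemma sgn_not (b : Bool) : sgn (!b) = -sgn b := by cases b <;> simp [sgn]

/-! ### Trace inequalities for powers of Hermitian matrices -/

section Trace

variable {d : Type*} [Fintype d] [DecidableEq d]

lemma exists_orthogonal_diagonalization {X : Matrix d d ℝ} (hX : X.IsHermitian) :
    ∃ (U : Matrix d d ℝ) (l : d → ℝ), U * Uᵀ = 1 ∧ Uᵀ * U = 1 ∧ U ∈ unitary (Matrix d d ℝ) ∧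
      ∀ q : ℕ, X ^ q = U * diagonal (fun j => l j ^ q) * Uᵀ := by
  have hu := hX.eigenvectorUnitary.2
  set U : Matrix d d ℝ := (hX.eigenvectorUnitary : Matrix d d ℝ) with hU
  have h1 : U * Uᵀ = 1 := by
    simpa [star_eq_conjTranspose] using (Unitary.mem_iff.1 hu).2
  have h2 : Uᵀ * U = 1 := by
    simpa [star_eq_conjTranspose] using (Unitary.mem_iff.1 hu).1
  have h3 : X = U * diagonal hX.eigenvalues * Uᵀ := by
    have := hX.spectral_theorem
    rw [Unitary.conjStarAlgAut_apply] at this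
    simpa [star_eq_conjTranspose] using this
  refine ⟨U, hX.eigenvalues, h1, h2, hu, fun q => ?_⟩
  induction q with
  | zero => simp [h1]
  | succ q ih =>
    rw [pow_succ, ih]
    nth_rewrite 2 [h3]
    calc U * diagonal (fun j => hX.eigenvalues j ^ q) * Uᵀ * (U * diagonal hX.eigenvalues * Uᵀ)
        = U * diagonal (fun j => hX.eigenvalues j ^ q) * (Uᵀ * U) * diagonal hX.eigenvalues * Uᵀ := by
          simp only [Matrix.mul_assoc]
      _ = _ := by
          rw [h2, Matrix.mul_one, Matrix.mul_assoc U, diagonal_mul_diagonal]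
          simp only [pow_succ]

/-- Diagonalize `X` and `Y` separately; the weights are the squared entries of `H` between the two
eigenbases. Since they do not depend on the exponents, trace inequalities reduce to scalar ones. -/
lemma trace_mul_pow_mul_pow {H X Y : Matrix d d ℝ} (hH : H.IsHermitian) (hX : X.IsHermitian)
    (hY : Y.IsHermitian) :
    ∃ (w : d → d → ℝ) (l r : d → ℝ), (∀ j k, 0 ≤ w j k) ∧
      ∀ p q : ℕ, (H * X ^ p * H * Y ^ q).trace = ∑ j, ∑ k, w j k * (l j ^ p * r k ^ q) := by
  obtain ⟨U, l, -, -, -, hl⟩ := exists_orthogonal_diagonalization hX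
  obtain ⟨W, r, -, -, -, hr⟩ := exists_orthogonal_diagonalization hY
  have hHt : Hᵀ = H := by simpa using hH.eq
  set G := Uᵀ * H * W with hG
  have hGt : Gᵀ = Wᵀ * H * U := by
    simp [hG, transpose_mul, hHt, Matrix.mul_assoc]
  refine ⟨fun j k => G j k ^ 2, l, r, fun j k => sq_nonneg _, fun p q => ?_⟩
  calc (H * X ^ p * H * Y ^ q).trace
      = (H * U * diagonal (fun j => l j ^ p) * G * diagonal (fun j => r j ^ q) * Wᵀ).trace := by
        rw [hl, hr, hG]; simp only [Matrix.mul_assoc]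
    _ = (Gᵀ * diagonal (fun j => l j ^ p) * G * diagonal (fun j => r j ^ q)).trace := by
        rw [trace_mul_comm, hGt]; simp only [Matrix.mul_assoc]
    _ = _ := by
        have ht (Z : Matrix d d ℝ) : Z.trace = ∑ k, Z k k := rfl
        rw [ht, Finset.sum_comm]
        refine Finset.sum_congr rfl fun k _ => ?_
        rw [mul_diagonal, Matrix.mul_apply, Finset.sum_mul]
        refine Finset.sum_congr rfl fun j _ => ?_
        rw [mul_diagonal, transpose_apply]
        ring

lemma pow_mul_pow_add_le (x y : ℝ) {q r p : ℕ} (h : q + r = 2 * p) :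
    x ^ q * y ^ r + x ^ r * y ^ q ≤ x ^ (2 * p) + y ^ (2 * p) := by
  -- Both factors have the same sign because powers are monotone on nonnegative reals.
  have key : (|x| ^ q - |y| ^ q) * (|x| ^ r - |y| ^ r) ≥ 0 := by
    rcases le_total |x| |y| with hxy | hxy
    · exact mul_nonneg_of_nonpos_of_nonpos
        (sub_nonpos.2 (pow_le_pow_left₀ (abs_nonneg _) hxy _))
        (sub_nonpos.2 (pow_le_pow_left₀ (abs_nonneg _) hxy _))
    · exact mul_nonneg
        (sub_nonneg.2 (pow_le_pow_left₀ (abs_nonneg _) hxy _))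
        (sub_nonneg.2 (pow_le_pow_left₀ (abs_nonneg _) hxy _))
  have h1 : x ^ q * y ^ r ≤ |x| ^ q * |y| ^ r := by
    rw [← abs_pow, ← abs_pow, ← abs_mul]; exact le_abs_self _
  have h2 : x ^ r * y ^ q ≤ |x| ^ r * |y| ^ q := by
    rw [← abs_pow, ← abs_pow, ← abs_mul]; exact le_abs_self _
  have h3 : |x| ^ q * |x| ^ r = x ^ (2 * p) := by
    rw [← pow_add, h]; exact (even_two_mul p).pow_abs x
  have h4 : |y| ^ q * |y| ^ r = y ^ (2 * p) := by
    rw [← pow_add, h]; exact (even_two_mul p).pow_abs y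
  nlinarith

lemma sum_trace_mul_pow_le {H X Y : Matrix d d ℝ} (hH : H.IsHermitian) (hX : X.IsHermitian)
    (hY : Y.IsHermitian) (p : ℕ) :
    2 * ∑ q ∈ range (2 * p + 1), (H * X ^ q * H * Y ^ (2 * p - q)).trace ≤
      (2 * p + 1) * ((H * H * X ^ (2 * p)).trace + (H * H * Y ^ (2 * p)).trace) := by
  obtain ⟨w, l, r, hw, h⟩ := trace_mul_pow_mul_pow hH hX hY
  have hx : (H * H * X ^ (2 * p)).trace = ∑ j, ∑ k, w j k * l j ^ (2 * p) := by
    have := h (2 * p) 0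
    simp only [pow_zero, mul_one] at this
    rw [← this, trace_mul_comm (H * X ^ (2 * p)) H, Matrix.mul_assoc]
  have hy : (H * H * Y ^ (2 * p)).trace = ∑ j, ∑ k, w j k * r k ^ (2 * p) := by
    have := h 0 (2 * p)
    simpa only [pow_zero, Matrix.mul_one, one_mul] using this
  have hrefl : ∑ q ∈ range (2 * p + 1), (H * X ^ (2 * p - q) * H * Y ^ q).trace =
      ∑ q ∈ range (2 * p + 1), (H * X ^ q * H * Y ^ (2 * p - q)).trace := by
    rw [← Finset.sum_range_reflect]
    refine Finset.sum_congr rfl fun q hq => ?_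
    have : q ≤ 2 * p := by simpa [Nat.lt_succ_iff] using hq
    rw [show 2 * p - (2 * p + 1 - 1 - q) = q by omega, show 2 * p + 1 - 1 - q = 2 * p - q by omega]
  rw [two_mul]
  nth_rewrite 1 [← hrefl]
  rw [← Finset.sum_add_distrib, hx, hy, ← Finset.sum_add_distrib]
  have hc : ((2 * p + 1 : ℝ)) = ((range (2 * p + 1)).card : ℝ) := by simp
  rw [hc, ← nsmul_eq_mul]
  refine Finset.sum_le_card_nsmul _ _ _ fun q hq => ?_
  have hq' : q ≤ 2 * p := by simpa [Nat.lt_succ_iff] using hq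
  rw [h, h, ← Finset.sum_add_distrib]
  refine Finset.sum_le_sum fun j _ => ?_
  rw [← Finset.sum_add_distrib, ← Finset.sum_add_distrib]
  refine Finset.sum_le_sum fun k _ => ?_
  rw [← mul_add, ← mul_add]
  exact mul_le_mul_of_nonneg_left (pow_mul_pow_add_le _ _ (by omega)) (hw j k)

omit [DecidableEq d] in
lemma trace_transpose_mul_self (Z : Matrix d d ℝ) :
    (Zᵀ * Z).trace = ∑ k, Zᵀ k ⬝ᵥ Zᵀ k := by
  simp [trace, Matrix.mul_apply, dotProduct]

lemma trace_pow_two_mul_nonneg {X : Matrix d d ℝ} (hX : X.IsHermitian) (p : ℕ) :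
    0 ≤ (X ^ (2 * p)).trace := by
  have hXp : (X ^ p)ᵀ = X ^ p := by simpa using (hX.pow p).eq
  have : X ^ (2 * p) = (X ^ p)ᵀ * X ^ p := by rw [hXp, two_mul, pow_add]
  rw [this, trace_transpose_mul_self]
  exact Finset.sum_nonneg fun k _ => by simpa using dotProduct_star_self_nonneg ((X ^ p)ᵀ k)

/-- The hypothesis `hv` is `∑ Aᵢ² ≼ v` as quadratic forms; it is applied to every column of `X ^ p`.
-/
lemma sum_trace_sq_mul_pow_le {ι : Type*} [Fintype ι] {A : ι → Matrix d d ℝ}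
    (hA : ∀ i, (A i).IsHermitian) {v : ℝ}
    (hv : ∀ x : d → ℝ, ∑ i, (A i *ᵥ x) ⬝ᵥ (A i *ᵥ x) ≤ v * (x ⬝ᵥ x))
    {X : Matrix d d ℝ} (hX : X.IsHermitian) (p : ℕ) :
    ∑ i, (A i * A i * X ^ (2 * p)).trace ≤ v * (X ^ (2 * p)).trace := by
  have hXp : (X ^ p)ᵀ = X ^ p := by simpa using (hX.pow p).eq
  have hs : X ^ (2 * p) = (X ^ p)ᵀ * X ^ p := by rw [hXp, two_mul, pow_add]
  have h1 : ∀ i, (A i * A i * X ^ (2 * p)).trace =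
      ∑ k, (A i *ᵥ (X ^ p)ᵀ k) ⬝ᵥ (A i *ᵥ (X ^ p)ᵀ k) := by
    intro i
    have hAi : (A i)ᵀ = A i := by simpa using (hA i).eq
    have : (A i * A i * X ^ (2 * p)).trace = ((A i * X ^ p)ᵀ * (A i * X ^ p)).trace := by
      rw [two_mul, pow_add, transpose_mul, hXp, hAi, ← Matrix.mul_assoc, trace_mul_comm]
      simp only [Matrix.mul_assoc]
    rw [this, trace_transpose_mul_self]
    rfl
  simp_rw [h1]
  rw [Finset.sum_comm, hs, trace_transpose_mul_self, Finset.mul_sum]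
  exact Finset.sum_le_sum fun k _ => hv _

lemma norm_pow_le_trace {X : Matrix d d ℝ} (hX : X.IsHermitian) {p : ℕ} (hp : p ≠ 0) :
    ‖X‖ ^ (2 * p) ≤ (X ^ (2 * p)).trace := by
  obtain ⟨U, l, h1, h2, hu, hl⟩ := exists_orthogonal_diagonalization hX
  have hn : ‖X‖ = ‖l‖ := by
    have hX1 := hl 1
    simp only [pow_one] at hX1
    have hut : Uᵀ ∈ unitary (Matrix d d ℝ) := by
      simpa [star_eq_conjTranspose] using Unitary.star_mem hu
    rw [hX1, CStarRing.norm_mul_mem_unitary _ hut, CStarRing.norm_mem_unitary_mul _ hu]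
    exact l2_opNorm_diagonal l
  have ht : (X ^ (2 * p)).trace = ∑ j, l j ^ (2 * p) := by
    rw [hl, trace_mul_comm, ← Matrix.mul_assoc, h2, Matrix.one_mul, trace_diagonal]
  rw [hn, ht]
  cases isEmpty_or_nonempty d
  · simp [Pi.norm_def, hp]
  · obtain ⟨j, hj⟩ := Finite.exists_max (fun j => ‖l j‖)
    have : ‖l‖ ≤ ‖l j‖ := (pi_norm_le_iff_of_nonneg (norm_nonneg _)).2 hj
    calc ‖l‖ ^ (2 * p) ≤ ‖l j‖ ^ (2 * p) := by gcongr
      _ = l j ^ (2 * p) := by rw [Real.norm_eq_abs]; exact (even_two_mul p).pow_abs _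
      _ ≤ _ := Finset.single_le_sum (f := fun j => l j ^ (2 * p))
          (fun j _ => (even_two_mul p).pow_nonneg _) (Finset.mem_univ j)

end Trace

/-! ### Noncommutative Khintchine inequality by exchanging one sign at a time -/

section Khintchine

variable {ι d : Type*} [Fintype ι] [DecidableEq ι] [Fintype d] [DecidableEq d]

/-- The signed sum `∑ i, ε i • A i`. -/
def signedSum (A : ι → Matrix d d ℝ) (e : ι → Bool) : Matrix d d ℝ := ∑ i, sgn (e i) • A i

/-- Flip the `i`-th sign. -/
def flipAt (i : ι) (e : ι → Bool) : ι → Bool := Function.update e i (!e i)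

omit [Fintype ι] in
lemma flipAt_involutive (i : ι) : Function.Involutive (flipAt i : (ι → Bool) → ι → Bool) := by
  intro e; ext j; by_cases h : j = i
  · subst h; simp [flipAt]
  · simp [flipAt, h]

omit [DecidableEq ι] [Fintype d] [DecidableEq d] in
lemma signedSum_isHermitian {A : ι → Matrix d d ℝ} (hA : ∀ i, (A i).IsHermitian)
    (e : ι → Bool) : (signedSum A e).IsHermitian := by
  simp only [IsHermitian, signedSum, conjTranspose_sum, conjTranspose_smul, star_trivial]
  exact Finset.sum_congr rfl fun i _ => by rw [(hA i).eq]

omit [Fintype d] [DecidableEq d] in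
lemma signedSum_sub_flipAt (A : ι → Matrix d d ℝ) (e : ι → Bool) (i : ι) :
    signedSum A e - signedSum A (flipAt i e) = (2 * sgn (e i)) • A i := by
  rw [signedSum, signedSum, ← Finset.sum_sub_distrib, Finset.sum_eq_single i]
  · simp only [flipAt, Function.update_self, sgn_not]; rw [← sub_smul]; congr 1; ring
  · intro j _ hj; simp [flipAt, hj]
  · simp

omit [Fintype ι] [DecidableEq ι] in
lemma expect_comp_involutive {α : Type*} [Fintype α] {g : α → α} (hg : Function.Involutive g)
    (f : α → ℝ) : 𝔼 a, f (g a) = 𝔼 a, f a :=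
  Fintype.expect_bijective g hg.bijective _ _ fun _ => rfl

lemma pow_succ_sub_pow_succ (X Y : Matrix d d ℝ) (n : ℕ) :
    X ^ (n + 1) - Y ^ (n + 1) = ∑ q ∈ range (n + 1), X ^ q * (X - Y) * Y ^ (n - q) := by
  induction n with
  | zero => simp
  | succ n ih =>
    rw [Finset.sum_range_succ]
    have : ∑ q ∈ range (n + 1), X ^ q * (X - Y) * Y ^ (n + 1 - q) =
        (∑ q ∈ range (n + 1), X ^ q * (X - Y) * Y ^ (n - q)) * Y := by
      rw [Finset.sum_mul]
      refine Finset.sum_congr rfl fun q hq => ?_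
      have : q ≤ n := by simpa [Nat.lt_succ_iff] using hq
      rw [show n + 1 - q = (n - q) + 1 by omega, pow_succ]; simp only [Matrix.mul_assoc]
    rw [this, ← ih]
    simp only [Nat.sub_self, pow_zero, Matrix.mul_one, Matrix.sub_mul, Matrix.mul_sub, ← pow_succ]
    abel

/-- A discrete integration by parts: peel off one factor `∑ εᵢ Aᵢ` and average each term with its
image under flipping `εᵢ`. The resulting difference of powers telescopes into mixed traces, which
`sum_trace_mul_pow_le` bounds by pure powers with equal expectations. -/
lemma expect_trace_signedSum_pow_succ {A : ι → Matrix d d ℝ} (hA : ∀ i, (A i).IsHermitian)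
    {v : ℝ} (hv : ∀ x : d → ℝ, ∑ i, (A i *ᵥ x) ⬝ᵥ (A i *ᵥ x) ≤ v * (x ⬝ᵥ x)) (p : ℕ) :
    𝔼 e, (signedSum A e ^ (2 * (p + 1))).trace ≤
      (2 * p + 1) * v * 𝔼 e, (signedSum A e ^ (2 * p)).trace := by
  set X := signedSum A with hXdef
  have hX : ∀ e, (X e).IsHermitian := signedSum_isHermitian hA
  have h1 : ∀ e, (X e ^ (2 * (p + 1))).trace =
      ∑ i, sgn (e i) * (A i * X e ^ (2 * p + 1)).trace := by
    intro e
    rw [show 2 * (p + 1) = (2 * p + 1) + 1 by ring, pow_succ' (X e)]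
    nth_rewrite 1 [hXdef]
    simp [signedSum, Finset.sum_mul, trace_sum, trace_smul]
  have h2 : ∀ (i : ι) (e : ι → Bool), sgn (e i) * (A i * X e ^ (2 * p + 1)).trace +
      sgn (flipAt i e i) * (A i * X (flipAt i e) ^ (2 * p + 1)).trace =
      2 * ∑ q ∈ range (2 * p + 1), (A i * X e ^ q * A i * X (flipAt i e) ^ (2 * p - q)).trace := by
    intro i e
    have : sgn (flipAt i e i) = - sgn (e i) := by simp [flipAt, sgn_not]
    rw [this, neg_mul, ← sub_eq_add_neg, ← mul_sub, ← trace_sub, ← Matrix.mul_sub,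
      pow_succ_sub_pow_succ, hXdef, signedSum_sub_flipAt, Finset.mul_sum, trace_sum,
      Finset.mul_sum, Finset.mul_sum]
    refine Finset.sum_congr rfl fun q _ => ?_
    simp only [Matrix.mul_smul, Matrix.smul_mul, trace_smul, smul_eq_mul, Matrix.mul_assoc]
    linear_combination (2 * (A i * (signedSum A e ^ q * (A i *
      signedSum A (flipAt i e) ^ (2 * p - q)))).trace) * sgn_mul_self (e i)
  have h3 : ∀ i, 𝔼 e, sgn (e i) * (A i * X e ^ (2 * p + 1)).trace ≤
      (2 * p + 1) * 𝔼 e, (A i * A i * X e ^ (2 * p)).trace := by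
    intro i
    have ha := expect_comp_involutive (flipAt_involutive i)
      (fun e : ι → Bool => sgn (e i) * (A i * X e ^ (2 * p + 1)).trace)
    have hb := expect_comp_involutive (flipAt_involutive i)
      (fun e : ι → Bool => (A i * A i * X e ^ (2 * p)).trace)
    have hc : 𝔼 e, (sgn (e i) * (A i * X e ^ (2 * p + 1)).trace +
        sgn (flipAt i e i) * (A i * X (flipAt i e) ^ (2 * p + 1)).trace) ≤
        𝔼 e, (2 * p + 1) * ((A i * A i * X e ^ (2 * p)).trace +
          (A i * A i * X (flipAt i e) ^ (2 * p)).trace) := by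
      refine Finset.expect_le_expect fun e _ => ?_
      rw [h2]
      exact sum_trace_mul_pow_le (hA i) (hX _) (hX _) p
    rw [Finset.expect_add_distrib, ← Finset.mul_expect, Finset.expect_add_distrib] at hc
    beta_reduce at ha hb
    rw [ha, hb] at hc
    linarith
  calc 𝔼 e, (X e ^ (2 * (p + 1))).trace
      = ∑ i, 𝔼 e, sgn (e i) * (A i * X e ^ (2 * p + 1)).trace := by
        simp_rw [h1]; exact Finset.expect_sum_comm _ _ _
    _ ≤ ∑ i, (2 * p + 1) * 𝔼 e, (A i * A i * X e ^ (2 * p)).trace :=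
        Finset.sum_le_sum fun i _ => h3 i
    _ = (2 * p + 1) * 𝔼 e, ∑ i, (A i * A i * X e ^ (2 * p)).trace := by
        rw [← Finset.mul_sum, Finset.expect_sum_comm]
    _ ≤ (2 * p + 1) * 𝔼 e, v * (X e ^ (2 * p)).trace := by
        refine mul_le_mul_of_nonneg_left (Finset.expect_le_expect fun e _ => ?_) (by positivity)
        exact sum_trace_sq_mul_pow_le hA hv (hX e) p
    _ = _ := by rw [← Finset.mul_expect, mul_assoc]

/-- The noncommutative Khintchine inequality in trace form. -/
theorem expect_trace_signedSum_pow_le {A : ι → Matrix d d ℝ} (hA : ∀ i, (A i).IsHermitian)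
    {v : ℝ} (hv0 : 0 ≤ v)
    (hv : ∀ x : d → ℝ, ∑ i, (A i *ᵥ x) ⬝ᵥ (A i *ᵥ x) ≤ v * (x ⬝ᵥ x)) (p : ℕ) :
    𝔼 e, (signedSum A e ^ (2 * p)).trace ≤ (2 * p * v) ^ p * Fintype.card d := by
  -- Fixing `p` lets each factor `2q + 1` of the recursion be bounded uniformly by `2p`.
  have key : ∀ q ≤ p, 𝔼 e, (signedSum A e ^ (2 * q)).trace ≤
      (2 * p * v) ^ q * Fintype.card d := by
    intro q
    induction q with
    | zero => intro _; simp
    | succ q ih =>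
      intro hq
      have h0 : 0 ≤ 𝔼 e, (signedSum A e ^ (2 * q)).trace := Finset.expect_nonneg fun e _ =>
        trace_pow_two_mul_nonneg (signedSum_isHermitian hA e) q
      have hqp : (2 * q + 1 : ℝ) ≤ 2 * p := by
        have : (q + 1 : ℝ) ≤ p := by exact_mod_cast hq
        linarith
      calc _ ≤ (2 * q + 1) * v * 𝔼 e, (signedSum A e ^ (2 * q)).trace :=
            expect_trace_signedSum_pow_succ hA hv q
        _ ≤ (2 * p * v) * ((2 * p * v) ^ q * Fintype.card d) := by
            gcongr
            exact ih (by omega)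
        _ = _ := by ring
  exact key p le_rfl

theorem expect_norm_signedSum_pow_le {A : ι → Matrix d d ℝ} (hA : ∀ i, (A i).IsHermitian)
    {v : ℝ} (hv0 : 0 ≤ v)
    (hv : ∀ x : d → ℝ, ∑ i, (A i *ᵥ x) ⬝ᵥ (A i *ᵥ x) ≤ v * (x ⬝ᵥ x)) {p : ℕ} (hp : p ≠ 0) :
    𝔼 e, ‖signedSum A e‖ ^ (2 * p) ≤ (2 * p * v) ^ p * Fintype.card d :=
  (Finset.expect_le_expect fun e _ => norm_pow_le_trace (signedSum_isHermitian hA e) hp).trans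
    (expect_trace_signedSum_pow_le hA hv0 hv p)

end Khintchine

/-! ### From the spectral norm to a degree-four certificate -/

section SumOfSquares

lemma dotProduct_mulVec_le_norm {d : Type*} [Fintype d] [DecidableEq d] (A : Matrix d d ℝ)
    (x : d → ℝ) : x ⬝ᵥ (A *ᵥ x) ≤ ‖A‖ * (x ⬝ᵥ x) := by
  have h1 := real_inner_le_norm (WithLp.toLp 2 x) (WithLp.toLp 2 (A *ᵥ x))
  have h2 := l2_opNorm_mulVec A (WithLp.toLp 2 x)
  have h3 : ‖WithLp.toLp 2 x‖ * ‖WithLp.toLp 2 x‖ = x ⬝ᵥ x := by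
    rw [← real_inner_self_eq_norm_mul_norm, EuclideanSpace.inner_toLp_toLp]; simp
  rw [EuclideanSpace.inner_toLp_toLp, star_trivial, dotProduct_comm] at h1
  calc x ⬝ᵥ (A *ᵥ x) ≤ _ := h1
    _ ≤ ‖WithLp.toLp 2 x‖ * (‖A‖ * ‖WithLp.toLp 2 x‖) :=
        mul_le_mul_of_nonneg_left h2 (norm_nonneg _)
    _ = ‖A‖ * (‖WithLp.toLp 2 x‖ * ‖WithLp.toLp 2 x‖) := by ring
    _ = _ := by rw [h3]

variable {m n : ℕ}

lemma vecMulVec_self_isHermitian {d : Type*} (u : d → ℝ) : (vecMulVec u u).IsHermitian := by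
  ext i j; simp [vecMulVec_apply, mul_comm]

lemma crossMatrix_isHermitian (a : Fin m → Fin n → ℝ) : (crossMatrix a).IsHermitian := by
  simp only [IsHermitian, crossMatrix, conjTranspose_sum, conjTranspose_smul, star_trivial]
  refine Finset.sum_congr rfl fun i _ => Finset.sum_congr rfl fun j _ => ?_
  rw [vecMulVec_self_isHermitian]

lemma tensorVec_dotProduct_tensorVec (u v x y : Fin n → ℝ) :
    tensorVec u v ⬝ᵥ tensorVec x y = (u ⬝ᵥ x) * (v ⬝ᵥ y) := by
  simp only [dotProduct, tensorVec, Fintype.sum_prod_type, Finset.sum_mul_sum]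
  exact Finset.sum_congr rfl fun i _ => Finset.sum_congr rfl fun j _ => by ring

lemma dotProduct_vecMulVec_mulVec {d : Type*} [Fintype d] (u x : d → ℝ) :
    x ⬝ᵥ (vecMulVec u u *ᵥ x) = (u ⬝ᵥ x) ^ 2 := by
  rw [vecMulVec_mulVec, dotProduct_smul, dotProduct_comm x u]
  simp [sq]

lemma eval_linearForm (u x : Fin n → ℝ) : MvPolynomial.eval x (linearForm u) = u ⬝ᵥ x := by
  simp [linearForm, dotProduct]

lemma eval_crossPolynomial (a : Fin m → Fin n → ℝ) (x : Fin n → ℝ) :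
    MvPolynomial.eval x (crossPolynomial a) =
      tensorVec x x ⬝ᵥ (crossMatrix a *ᵥ tensorVec x x) := by
  simp only [crossPolynomial, crossMatrix, map_sum, map_mul, map_pow, eval_linearForm,
    MvPolynomial.eval_C, sum_mulVec, dotProduct_sum, smul_mulVec, dotProduct_smul,
    dotProduct_vecMulVec_mulVec, tensorVec_dotProduct_tensorVec, smul_eq_mul]
  exact Finset.sum_congr rfl fun i _ => Finset.sum_congr rfl fun j _ => by ring

lemma totalDegree_linearForm_le (u : Fin n → ℝ) : (linearForm u).totalDegree ≤ 1 := by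
  refine MvPolynomial.totalDegree_finsetSum_le fun k _ => ?_
  refine (MvPolynomial.totalDegree_mul _ _).trans ?_
  simp

lemma totalDegree_crossPolynomial_le (a : Fin m → Fin n → ℝ) :
    (crossPolynomial a).totalDegree ≤ 4 := by
  refine MvPolynomial.totalDegree_finsetSum_le fun i _ =>
    MvPolynomial.totalDegree_finsetSum_le fun j _ => ?_
  have h1 := totalDegree_linearForm_le (a i)
  have h2 := totalDegree_linearForm_le (a j)
  have h3 := MvPolynomial.totalDegree_pow (linearForm (a i)) 2
  have h4 := MvPolynomial.totalDegree_pow (linearForm (a j)) 2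
  have h5 := MvPolynomial.totalDegree_mul (MvPolynomial.C (a i ⬝ᵥ a j)) (linearForm (a i) ^ 2)
  have h6 := MvPolynomial.totalDegree_mul (MvPolynomial.C (a i ⬝ᵥ a j) * linearForm (a i) ^ 2)
    (linearForm (a j) ^ 2)
  rw [MvPolynomial.totalDegree_C] at h5
  omega

lemma totalDegree_sum_X_sq_le (n : ℕ) :
    (∑ k : Fin n, MvPolynomial.X k ^ 2 : MvPolynomial (Fin n) ℝ).totalDegree ≤ 2 :=
  MvPolynomial.totalDegree_finsetSum_le fun k _ =>
    (MvPolynomial.totalDegree_pow _ 2).trans (by simp)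

lemma totalDegree_sphereConstraint_le (n : ℕ) : (sphereConstraint n).totalDegree ≤ 2 :=
  (MvPolynomial.totalDegree_sub _ _).trans
    (max_le (totalDegree_sum_X_sq_le n) (by simp))

/-- A spectral norm bound on the flattening yields a degree-four sum-of-squares certificate. -/
theorem sosLE_crossPolynomial (a : Fin m → Fin n → ℝ) {B : ℝ} (hB : ‖crossMatrix a‖ ≤ B) :
    SosLE ![sphereConstraint n] 4 (crossPolynomial a) (MvPolynomial.C B) := by
  have hpsd : (B • (1 : Matrix (Fin n × Fin n) (Fin n × Fin n) ℝ) - crossMatrix a).PosSemidef := by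
    refine PosSemidef.of_dotProduct_mulVec_nonneg ?_ fun x => ?_
    · refine IsHermitian.sub ?_ (crossMatrix_isHermitian a)
      simp [IsHermitian]
    · rw [star_trivial, sub_mulVec, dotProduct_sub, smul_mulVec, one_mulVec, dotProduct_smul,
        smul_eq_mul, sub_nonneg]
      have hx : 0 ≤ x ⬝ᵥ x := by simpa using dotProduct_star_self_nonneg x
      exact (dotProduct_mulVec_le_norm _ x).trans (mul_le_mul_of_nonneg_right hB hx)
  obtain ⟨l, v, hv⟩ := Matrix.posSemidef_iff_eq_sum_vecMulVec.1 hpsd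
  simp only [star_trivial] at hv
  -- The squares are the forms `⟨vᵢ, x ⊗ x⟩`; the multiplier comes from `B - B‖x‖⁴ = -B(‖x‖² - 1)(1
  -- + ‖x‖²)`.
  refine ⟨(MvPolynomial.totalDegree_sub _ _).trans
      (max_le (by simp) (totalDegree_crossPolynomial_le a)), l,
    fun i => ∑ q : Fin n × Fin n, MvPolynomial.C (v i q) * (MvPolynomial.X q.1 * MvPolynomial.X q.2),
    ![-MvPolynomial.C B * (1 + ∑ k, MvPolynomial.X k ^ 2)], fun i => ?_, fun j => ?_, ?_⟩
  · have : (∑ q : Fin n × Fin n, MvPolynomial.C (v i q) * (MvPolynomial.X q.1 *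
        MvPolynomial.X q.2) : MvPolynomial (Fin n) ℝ).totalDegree ≤ 2 := by
      refine MvPolynomial.totalDegree_finsetSum_le fun q _ => ?_
      have h1 := MvPolynomial.totalDegree_mul (MvPolynomial.C (v i q) : MvPolynomial (Fin n) ℝ)
        (MvPolynomial.X q.1 * MvPolynomial.X q.2)
      have h2 := MvPolynomial.totalDegree_mul (MvPolynomial.X q.1 : MvPolynomial (Fin n) ℝ)
        (MvPolynomial.X q.2)
      rw [MvPolynomial.totalDegree_C] at h1
      rw [MvPolynomial.totalDegree_X, MvPolynomial.totalDegree_X] at h2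
      omega
    exact Nat.mul_le_mul_left 2 this
  · fin_cases j
    have h1 := totalDegree_sphereConstraint_le n
    have h2 := totalDegree_sum_X_sq_le n
    have h3 : (1 + ∑ k : Fin n, MvPolynomial.X k ^ 2 : MvPolynomial (Fin n) ℝ).totalDegree ≤ 2 :=
      (MvPolynomial.totalDegree_add _ _).trans (max_le (by simp) h2)
    have h4 := MvPolynomial.totalDegree_mul (-MvPolynomial.C B : MvPolynomial (Fin n) ℝ)
      (1 + ∑ k : Fin n, MvPolynomial.X k ^ 2)
    rw [MvPolynomial.totalDegree_neg, MvPolynomial.totalDegree_C] at h4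
    have h5 := MvPolynomial.totalDegree_mul (sphereConstraint n)
      (-MvPolynomial.C B * (1 + ∑ k : Fin n, MvPolynomial.X k ^ 2))
    simp only [Fin.zero_eta, Matrix.cons_val_zero]
    omega
  · refine MvPolynomial.funext fun x => ?_
    have hw : tensorVec x x ⬝ᵥ ((B • (1 : Matrix (Fin n × Fin n) (Fin n × Fin n) ℝ) -
        crossMatrix a) *ᵥ tensorVec x x) = ∑ i, (v i ⬝ᵥ tensorVec x x) ^ 2 := by
      rw [hv, sum_mulVec, dotProduct_sum]
      simp only [dotProduct_vecMulVec_mulVec]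
    rw [sub_mulVec, dotProduct_sub, smul_mulVec, one_mulVec, dotProduct_smul, smul_eq_mul,
      ← eval_crossPolynomial, tensorVec_dotProduct_tensorVec] at hw
    have hh : ∀ i, MvPolynomial.eval x (∑ q : Fin n × Fin n, MvPolynomial.C (v i q) *
        (MvPolynomial.X q.1 * MvPolynomial.X q.2)) = v i ⬝ᵥ tensorVec x x := by
      intro i; simp [dotProduct, tensorVec]
    have hx : ∑ k, x k ^ 2 = x ⬝ᵥ x := by simp [dotProduct, sq]
    simp only [map_sub, map_add, map_sum, map_pow, Fin.sum_univ_one, Matrix.cons_val_zero, map_mul,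
      sphereConstraint, map_neg, map_one, MvPolynomial.eval_C, MvPolynomial.eval_X] at hh ⊢
    simp only [hh, ← hw, hx]
    ring

end SumOfSquares

/-! ### Sign symmetries, coherence, and the norm of the outer-product sum -/

section SignArrays

variable {m n : ℕ}

lemma component_apply (s : Fin m → Fin n → Bool) (i : Fin m) (k : Fin n) :
    component s i k = sgn (s i k) * (1 / √(n : ℝ)) := by
  unfold component sgn; split_ifs <;> simp

lemma component_sq (s : Fin m → Fin n → Bool) (i : Fin m) (k : Fin n) :
    component s i k * component s i k = 1 / n := by
  rw [component_apply, mul_mul_mul_comm, sgn_mul_self, one_mul, div_mul_div_comm, one_mul,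
    Real.mul_self_sqrt (Nat.cast_nonneg n)]

lemma component_dotProduct_self [NeZero n] (s : Fin m → Fin n → Bool) (i : Fin m) :
    component s i ⬝ᵥ component s i = 1 := by
  have : (n : ℝ) ≠ 0 := Nat.cast_ne_zero.2 (NeZero.ne n)
  simp only [dotProduct, component_sq]
  simp [this]

/-- The sum of the outer products `aᵢ aᵢᵀ`. -/
def outerSum (a : Fin m → Fin n → ℝ) : Matrix (Fin n) (Fin n) ℝ := ∑ i, vecMulVec (a i) (a i)

/-- The largest absolute inner product of two distinct components. -/
def coherence (a : Fin m → Fin n → ℝ) : ℝ :=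
  ‖fun q : Fin m × Fin m => if q.1 = q.2 then 0 else a q.1 ⬝ᵥ a q.2‖

lemma outerSum_isHermitian (a : Fin m → Fin n → ℝ) : (outerSum a).IsHermitian := by
  simp only [IsHermitian, outerSum, conjTranspose_sum]
  exact Finset.sum_congr rfl fun i _ => vecMulVec_self_isHermitian _

lemma sum_dotProduct_sq_le (a : Fin m → Fin n → ℝ) (x : Fin n → ℝ) :
    ∑ i, (a i ⬝ᵥ x) ^ 2 ≤ ‖outerSum a‖ * (x ⬝ᵥ x) := by
  refine le_trans (le_of_eq ?_) (dotProduct_mulVec_le_norm (outerSum a) x)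
  simp only [outerSum, sum_mulVec, dotProduct_sum, dotProduct_vecMulVec_mulVec]

lemma dotProduct_sq_le_coherence_sq (a : Fin m → Fin n → ℝ) {i j : Fin m} (h : i ≠ j) :
    (a i ⬝ᵥ a j) ^ 2 ≤ coherence a ^ 2 := by
  have := norm_le_pi_norm
    (fun q : Fin m × Fin m => if q.1 = q.2 then 0 else a q.1 ⬝ᵥ a q.2) (i, j)
  simp only [h, if_false, Real.norm_eq_abs] at this
  exact sq_le_sq' (by have := (abs_le.1 this).1; exact this) (abs_le.1 this).2

lemma coherence_pow_le_sum (a : Fin m → Fin n → ℝ) {q : ℕ} (hq : q ≠ 0) :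
    coherence a ^ (2 * q) ≤ ∑ i, ∑ j, if i = j then 0 else (a i ⬝ᵥ a j) ^ (2 * q) := by
  have hnn : ∀ z : Fin m × Fin m, 0 ≤ if z.1 = z.2 then 0 else (a z.1 ⬝ᵥ a z.2) ^ (2 * q) := by
    intro z; split_ifs
    · exact le_rfl
    · exact (even_two_mul q).pow_nonneg _
  rw [← Fintype.sum_prod_type' (f := fun i j => if i = j then 0 else (a i ⬝ᵥ a j) ^ (2 * q))]
  cases isEmpty_or_nonempty (Fin m × Fin m) with
  | inl h => rw [coherence]; simp [Pi.norm_def, hq, Finset.univ_eq_empty]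
  | inr h =>
    set f := fun z : Fin m × Fin m => if z.1 = z.2 then 0 else a z.1 ⬝ᵥ a z.2 with hf
    obtain ⟨z, hz⟩ := Finite.exists_max (fun z => ‖f z‖)
    have h1 : coherence a ≤ ‖f z‖ := (pi_norm_le_iff_of_nonneg (norm_nonneg _)).2 hz
    calc coherence a ^ (2 * q) ≤ ‖f z‖ ^ (2 * q) :=
          pow_le_pow_left₀ (norm_nonneg _) h1 _
      _ = f z ^ (2 * q) := by rw [Real.norm_eq_abs]; exact (even_two_mul q).pow_abs _
      _ = if z.1 = z.2 then 0 else (a z.1 ⬝ᵥ a z.2) ^ (2 * q) := by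
          simp only [hf]; split_ifs
          · simp [hq]
          · rfl
      _ ≤ _ := Finset.single_le_sum
          (f := fun z : Fin m × Fin m => if z.1 = z.2 then 0 else (a z.1 ⬝ᵥ a z.2) ^ (2 * q))
          (fun z _ => hnn z) (Finset.mem_univ z)

/-- Inserts auxiliary random signs for free, so that Khintchine can be applied for each fixed array.
-/
lemma expect_expect_involutive {α ε : Type*} [Fintype α] [Fintype ε] [Nonempty ε]
    {g : ε → α → α} (hg : ∀ e, Function.Involutive (g e)) (f : α → ℝ) :
    𝔼 a, 𝔼 e, f (g e a) = 𝔼 a, f a := by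
  rw [Finset.expect_comm]
  simp only [expect_comp_involutive (hg _), Fintype.expect_const]

/-- Multiply the entries of row `j` by the signs `t`. -/
def flipRow (j : Fin m) (t : Fin n → Bool) (s : Fin m → Fin n → Bool) : Fin m → Fin n → Bool :=
  Function.update s j fun k => t k == s j k

/-- Multiply each row by a sign. -/
def flipRows (e : Fin m → Bool) (s : Fin m → Fin n → Bool) : Fin m → Fin n → Bool :=
  fun i k => e i == s i k

lemma flipRow_involutive (j : Fin m) (t : Fin n → Bool) : Function.Involutive (flipRow j t) := by
  intro s; ext i k; by_cases h : i = j
  · subst h; simp [flipRow]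
  · simp [flipRow, h]

lemma flipRows_involutive (e : Fin m → Bool) :
    Function.Involutive (flipRows e : (Fin m → Fin n → Bool) → _) := by
  intro s; ext i k; simp [flipRows]

lemma component_flipRows (e : Fin m → Bool) (s : Fin m → Fin n → Bool) (i : Fin m) :
    component (flipRows e s) i = sgn (e i) • component s i := by
  ext k; simp only [component_apply, flipRows, sgn_beq, Pi.smul_apply, smul_eq_mul]; ring

lemma vecMulVec_component_flipRows (e : Fin m → Bool) (s : Fin m → Fin n → Bool) (i : Fin m) :
    vecMulVec (component (flipRows e s) i) (component (flipRows e s) i) =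
      vecMulVec (component s i) (component s i) := by
  rw [component_flipRows, smul_vecMulVec, vecMulVec_smul, smul_smul, sgn_mul_self, one_smul]

lemma outerSum_flipRows (e : Fin m → Bool) (s : Fin m → Fin n → Bool) :
    outerSum (component (flipRows e s)) = outerSum (component s) := by
  simp only [outerSum, vecMulVec_component_flipRows]

/-- Randomizing the signs of row `j` alone makes the inner product a scalar Rademacher sum of
variance `1/n`, treated by Khintchine with `1 × 1` matrices. -/
lemma expect_dotProduct_pow_le [NeZero n] {i j : Fin m} (h : i ≠ j) (p : ℕ) :
    𝔼 s : Fin m → Fin n → Bool, (component s i ⬝ᵥ component s j) ^ (2 * p) ≤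
      (2 * p * (1 / n : ℝ)) ^ p := by
  have hn : (n : ℝ) ≠ 0 := Nat.cast_ne_zero.2 (NeZero.ne n)
  rw [← expect_expect_involutive (flipRow_involutive j)]
  refine Finset.expect_le Finset.univ_nonempty fun s _ => ?_
  set A : Fin n → Matrix Unit Unit ℝ :=
    fun k => (component s i k * component s j k) • (1 : Matrix Unit Unit ℝ) with hAdef
  have hA : ∀ k, (A k).IsHermitian := fun k => by simp [IsHermitian, hAdef]
  have hv : ∀ x : Unit → ℝ, ∑ k, (A k *ᵥ x) ⬝ᵥ (A k *ᵥ x) ≤ (1 / n : ℝ) * (x ⬝ᵥ x) := by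
    intro x
    have : ∀ k, (A k *ᵥ x) ⬝ᵥ (A k *ᵥ x) = (1 / n : ℝ) * (1 / n) * (x ⬝ᵥ x) := by
      intro k
      rw [hAdef]
      simp only [smul_mulVec, one_mulVec, dotProduct_smul, smul_dotProduct, smul_eq_mul]
      linear_combination (component s j k * component s j k * (x ⬝ᵥ x)) * component_sq s i k +
        (1 / n * (x ⬝ᵥ x)) * component_sq s j k
    simp only [this, Finset.sum_const, Finset.card_univ, Fintype.card_fin, nsmul_eq_mul]
    exact le_of_eq (by field_simp)
  have key := expect_trace_signedSum_pow_le hA (by positivity) hv p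
  rw [Fintype.card_unit, Nat.cast_one, mul_one] at key
  refine le_trans (le_of_eq (Finset.expect_congr rfl fun t _ => ?_)) key
  have h1 : signedSum A t = (component (flipRow j t s) i ⬝ᵥ component (flipRow j t s) j) •
      (1 : Matrix Unit Unit ℝ) := by
    rw [signedSum, dotProduct, Finset.sum_smul]
    refine Finset.sum_congr rfl fun k _ => ?_
    rw [hAdef, smul_smul]
    congr 1
    simp only [component_apply, flipRow, Function.update_self, Function.update_of_ne h, sgn_beq]
    ring
  rw [h1, smul_pow, one_pow, trace_smul, trace_one]
  simp

lemma expect_coherence_pow_le [NeZero n] {p : ℕ} (hp : p ≠ 0) :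
    𝔼 s : Fin m → Fin n → Bool, coherence (component s) ^ (2 * p) ≤
      m ^ 2 * (2 * p * (1 / n : ℝ)) ^ p := by
  calc _ ≤ 𝔼 s : Fin m → Fin n → Bool, ∑ i, ∑ j, (if i = j then 0 else
          (component s i ⬝ᵥ component s j) ^ (2 * p)) :=
        Finset.expect_le_expect fun s _ => coherence_pow_le_sum _ hp
    _ = ∑ i : Fin m, ∑ j : Fin m, 𝔼 s : Fin m → Fin n → Bool, (if i = j then 0 else
          (component s i ⬝ᵥ component s j) ^ (2 * p)) := by
        rw [Finset.expect_sum_comm]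
        exact Finset.sum_congr rfl fun i _ => Finset.expect_sum_comm _ _ _
    _ ≤ ∑ i : Fin m, ∑ j : Fin m, (2 * p * (1 / n : ℝ)) ^ p := by
        refine Finset.sum_le_sum fun i _ => Finset.sum_le_sum fun j _ => ?_
        by_cases h : i = j
        · simp only [h, if_true, Finset.expect_const_zero]; positivity
        · simp only [h, if_false]; exact expect_dotProduct_pow_le h p
    _ = _ := by simp; ring

/-- The Hermitian dilation of the matrix unit at `(k, j)`, scaled by `1 / √n`. -/
noncomputable def dilationUnit (q : Fin m × Fin n) : Matrix (Fin n ⊕ Fin m) (Fin n ⊕ Fin m) ℝ :=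
  (1 / √(n : ℝ)) • (single (Sum.inl q.2) (Sum.inr q.1) 1 + single (Sum.inr q.1) (Sum.inl q.2) 1)

lemma dilationUnit_isHermitian (q : Fin m × Fin n) : (dilationUnit q).IsHermitian := by
  simp [IsHermitian, dilationUnit, add_comm]

lemma dilationUnit_mulVec_dotProduct_self (q : Fin m × Fin n) (x : Fin n ⊕ Fin m → ℝ) :
    (dilationUnit q *ᵥ x) ⬝ᵥ (dilationUnit q *ᵥ x) =
      (1 / n : ℝ) * (x (Sum.inl q.2) ^ 2 + x (Sum.inr q.1) ^ 2) := by
  have h1 : dilationUnit q *ᵥ x = (1 / √(n : ℝ)) •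
      (Pi.single (Sum.inl q.2) (x (Sum.inr q.1)) + Pi.single (Sum.inr q.1) (x (Sum.inl q.2))) := by
    rw [dilationUnit, smul_mulVec, add_mulVec]
    congr 2 <;> (ext b; simp [single_mulVec, Pi.single, Function.update_apply])
  rw [h1, smul_dotProduct, dotProduct_smul, smul_smul, div_mul_div_comm, one_mul,
    Real.mul_self_sqrt (Nat.cast_nonneg n), smul_eq_mul]
  simp [dotProduct_add]
  left; ring

lemma signedSum_dilationUnit (s : Fin m → Fin n → Bool) :
    signedSum dilationUnit (fun q => s q.1 q.2) =
      fromBlocks 0 (of fun k j => component s j k) (of fun j k => component s j k) 0 := by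
  ext a b
  simp only [signedSum, Matrix.sum_apply, Matrix.smul_apply, dilationUnit, Matrix.add_apply,
    single_apply, Fintype.sum_prod_type]
  rcases a with k | j <;> rcases b with k' | j' <;>
    simp [component_apply, ite_and]

lemma outerSum_eq_mul (a : Fin m → Fin n → ℝ) :
    outerSum a = (of fun k j => a j k) * (of fun j k => a j k : Matrix (Fin m) (Fin n) ℝ) := by
  ext k l; simp [outerSum, Matrix.sum_apply, vecMulVec_apply, Matrix.mul_apply]

/-- The square of the dilation is block diagonal, with blocks the outer-product sum and the Gram
matrix; the Gram block contributes a nonnegative trace and is dropped. -/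
lemma norm_outerSum_pow_le (s : Fin m → Fin n → Bool) {p : ℕ} (hp : p ≠ 0) :
    ‖outerSum (component s)‖ ^ (2 * p) ≤
      (signedSum dilationUnit (fun q => s q.1 q.2) ^ (2 * (2 * p))).trace := by
  set T : Matrix (Fin m) (Fin m) ℝ :=
    (of fun j k => component s j k) * (of fun k j => component s j k) with hT
  have hTH : T.IsHermitian := by
    ext i j; simp [hT, Matrix.mul_apply, mul_comm]
  have h1 : signedSum dilationUnit (fun q => s q.1 q.2) ^ 2 =
      fromBlocks (outerSum (component s)) 0 0 T := by
    rw [signedSum_dilationUnit, sq, fromBlocks_multiply, outerSum_eq_mul]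
    simp [hT]
  rw [pow_mul (signedSum dilationUnit _), h1, fromBlocks_diagonal_pow]
  have h4 : (fromBlocks (outerSum (component s) ^ (2 * p)) 0 0 (T ^ (2 * p))).trace =
      (outerSum (component s) ^ (2 * p)).trace + (T ^ (2 * p)).trace := by
    simp [Matrix.trace, Fintype.sum_sum_type]
  rw [h4]
  have h2 := norm_pow_le_trace (outerSum_isHermitian (component s)) hp
  have h3 := trace_pow_two_mul_nonneg hTH p
  linarith

/-- The dilation has variance `m/n` on the first summand and `1` on the second; `n ≤ m` makes `m/n`
the larger. -/
lemma expect_norm_outerSum_pow_le [NeZero n] (hnm : n ≤ m) {p : ℕ} (hp : p ≠ 0) :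
    𝔼 s : Fin m → Fin n → Bool, ‖outerSum (component s)‖ ^ (2 * p) ≤
      (4 * p * (m / n : ℝ)) ^ (2 * p) * (n + m) := by
  have hn : (n : ℝ) ≠ 0 := Nat.cast_ne_zero.2 (NeZero.ne n)
  have hv : ∀ x : Fin n ⊕ Fin m → ℝ,
      ∑ q : Fin m × Fin n, (dilationUnit q *ᵥ x) ⬝ᵥ (dilationUnit q *ᵥ x) ≤
        (m / n : ℝ) * (x ⬝ᵥ x) := by
    intro x
    have hx : x ⬝ᵥ x = ∑ k, x (Sum.inl k) ^ 2 + ∑ j, x (Sum.inr j) ^ 2 := by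
      simp [dotProduct, Fintype.sum_sum_type, sq]
    simp only [dilationUnit_mulVec_dotProduct_self]
    rw [← Finset.mul_sum, Fintype.sum_prod_type, hx]
    simp only [Finset.sum_add_distrib, Finset.sum_const, Finset.card_univ, Fintype.card_fin,
      nsmul_eq_mul, ← Finset.mul_sum]
    have h0 : 0 ≤ ∑ j, x (Sum.inr j) ^ 2 := Finset.sum_nonneg fun j _ => sq_nonneg _
    have h1 : (n : ℝ) ≤ m := by exact_mod_cast hnm
    rw [div_eq_mul_one_div (m : ℝ), mul_comm (m : ℝ) (1 / (n : ℝ)), mul_assoc]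
    refine mul_le_mul_of_nonneg_left ?_ (by positivity)
    nlinarith
  have key := expect_trace_signedSum_pow_le (A := dilationUnit (m := m) (n := n))
    dilationUnit_isHermitian (by positivity) hv (2 * p)
  have heq : 𝔼 s : Fin m → Fin n → Bool,
      (signedSum dilationUnit (fun q : Fin m × Fin n => s q.1 q.2) ^ (2 * (2 * p))).trace =
      𝔼 e, (signedSum (dilationUnit (m := m) (n := n)) e ^ (2 * (2 * p))).trace :=
    Fintype.expect_equiv (Equiv.curry (Fin m) (Fin n) Bool).symm _ _ fun s => rfl
  calc _ ≤ _ := Finset.expect_le_expect fun s _ => norm_outerSum_pow_le s hp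
    _ ≤ _ := heq.le.trans key
    _ = _ := by
      simp only [Fintype.card_sum, Fintype.card_fin]; push_cast; ring

end SignArrays

/-! ### Decoupling and two conditional applications of Khintchine -/

section Decoupling

variable {m n : ℕ}

lemma expect_sgn (i : Fin m) : 𝔼 I : Fin m → Bool, sgn (I i) = 0 := by
  have h := expect_comp_involutive (flipAt_involutive i) (fun I : Fin m → Bool => sgn (I i))
  simp only [flipAt, Function.update_self, sgn_not, Finset.expect_neg_distrib] at h
  linarith

lemma expect_sgn_mul_sgn {i j : Fin m} (hij : i ≠ j) :
    𝔼 I : Fin m → Bool, sgn (I i) * sgn (I j) = 0 := by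
  have h := expect_comp_involutive (flipAt_involutive i)
    (fun I : Fin m → Bool => sgn (I i) * sgn (I j))
  simp only [flipAt, Function.update_self, Function.update_of_ne hij.symm, sgn_not, neg_mul,
    Finset.expect_neg_distrib] at h
  linarith

/-- The indicator of `i ∈ I`, `j ∉ I`. -/
def cutIndicator (I : Fin m → Bool) (i j : Fin m) : ℝ := if I i = true ∧ I j = false then 1 else 0

lemma cutIndicator_eq (I : Fin m → Bool) (i j : Fin m) :
    cutIndicator I i j = 1 / 4 * (1 + sgn (I i) - sgn (I j) - sgn (I i) * sgn (I j)) := by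
  unfold cutIndicator sgn
  cases I i <;> cases I j <;> norm_num

lemma expect_cutIndicator {i j : Fin m} (hij : i ≠ j) :
    𝔼 I : Fin m → Bool, cutIndicator I i j = 1 / 4 := by
  simp only [cutIndicator_eq, ← Finset.mul_expect, Finset.expect_sub_distrib,
    Finset.expect_add_distrib, expect_sgn, expect_sgn_mul_sgn hij, Fintype.expect_const]
  norm_num

lemma cutIndicator_self (I : Fin m → Bool) (i : Fin m) : cutIndicator I i i = 0 := by
  unfold cutIndicator; cases I i <;> simp

/-- The terms of the cross matrix that are cut by `I`. -/
def cutMatrix (I : Fin m → Bool) (a : Fin m → Fin n → ℝ) :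
    Matrix (Fin n × Fin n) (Fin n × Fin n) ℝ :=
  ∑ i, ∑ j, (cutIndicator I i j * (a i ⬝ᵥ a j)) •
    vecMulVec (tensorVec (a i) (a j)) (tensorVec (a i) (a j))

/-- A uniform set `I` separates an ordered pair `i ≠ j` with probability `1/4`, whence the factor
`4`. -/
lemma crossMatrix_eq_sum_cutMatrix (a : Fin m → Fin n → ℝ) :
    crossMatrix a = ∑ I : Fin m → Bool, (4 / Fintype.card (Fin m → Bool) : ℝ) • cutMatrix I a := by
  have hc : ∀ i j : Fin m, ∑ I : Fin m → Bool,
      (4 / Fintype.card (Fin m → Bool) : ℝ) * cutIndicator I i j = if i = j then 0 else 1 := by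
    intro i j
    split_ifs with h
    · subst h; simp [cutIndicator_self]
    · have := expect_cutIndicator h
      rw [Fintype.expect_eq_sum_div_card] at this
      rw [← Finset.mul_sum, div_mul_eq_mul_div, mul_div_assoc, this]; norm_num
  simp only [cutMatrix, Finset.smul_sum, smul_smul, ← mul_assoc]
  rw [Finset.sum_comm, crossMatrix]
  refine Finset.sum_congr rfl fun i _ => ?_
  rw [Finset.sum_comm]
  simp only [← Finset.sum_smul, ← Finset.sum_mul, hc, ite_mul, zero_mul, one_mul, ite_smul,
    zero_smul]
  rw [← Finset.sum_subset (Finset.subset_univ (Finset.univ.erase i))]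
  · refine Finset.sum_congr rfl fun j hj => ?_
    rw [if_neg (Finset.ne_of_mem_erase hj).symm]
  · intro j _ hj
    simp only [Finset.mem_erase, Finset.mem_univ, and_true, not_not] at hj
    simp [hj]

/-- Decoupling: the powers of the norm of the cross matrix are controlled by those of its cuts. -/
lemma norm_crossMatrix_pow_le (a : Fin m → Fin n → ℝ) (p : ℕ) :
    ‖crossMatrix a‖ ^ (2 * p) ≤ 16 ^ p * 𝔼 I : Fin m → Bool, ‖cutMatrix I a‖ ^ (2 * p) := by
  set c : ℝ := (Fintype.card (Fin m → Bool) : ℝ) with hc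
  have hc0 : 0 < c := by rw [hc]; exact_mod_cast Fintype.card_pos
  have h1 : ‖crossMatrix a‖ ≤ 4 * ∑ I : Fin m → Bool, c⁻¹ * ‖cutMatrix I a‖ := by
    rw [crossMatrix_eq_sum_cutMatrix, Finset.mul_sum]
    refine (norm_sum_le _ _).trans (Finset.sum_le_sum fun I _ => ?_)
    rw [norm_smul, Real.norm_of_nonneg (by positivity), ← hc, div_eq_mul_inv, mul_assoc]
  have h2 := Real.pow_arith_mean_le_arith_mean_pow (Finset.univ : Finset (Fin m → Bool))
    (fun _ => c⁻¹) (fun I => ‖cutMatrix I a‖) (fun _ _ => by positivity)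
    (by rw [Finset.sum_const, Finset.card_univ, nsmul_eq_mul]; exact mul_inv_cancel₀ hc0.ne')
    (fun _ _ => norm_nonneg _) (2 * p)
  calc ‖crossMatrix a‖ ^ (2 * p)
      ≤ (4 * ∑ I : Fin m → Bool, c⁻¹ * ‖cutMatrix I a‖) ^ (2 * p) := by gcongr
    _ = 16 ^ p * (∑ I : Fin m → Bool, c⁻¹ * ‖cutMatrix I a‖) ^ (2 * p) := by
        rw [mul_pow, pow_mul 4]; norm_num
    _ ≤ 16 ^ p * ∑ I : Fin m → Bool, c⁻¹ * ‖cutMatrix I a‖ ^ (2 * p) := by gcongr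
    _ = _ := by
        rw [Fintype.expect_eq_sum_div_card, ← Finset.mul_sum, div_eq_inv_mul]

/-- The inner sum `∑ j, ⟨aᵢ, aⱼ⟩ aⱼ aⱼᵀ` over the indices `j` separated from `i` by `I`. -/
def innerSum (I : Fin m → Bool) (i : Fin m) (a : Fin m → Fin n → ℝ) : Matrix (Fin n) (Fin n) ℝ :=
  ∑ j, (cutIndicator I i j * (a i ⬝ᵥ a j)) • vecMulVec (a j) (a j)

/-- The `i`-th block `aᵢ aᵢᵀ ⊗ innerSum` of the matrix cut by `I`. -/
def cutBlock (I : Fin m → Bool) (a : Fin m → Fin n → ℝ) (i : Fin m) :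
    Matrix (Fin n × Fin n) (Fin n × Fin n) ℝ :=
  ∑ j, (cutIndicator I i j * (a i ⬝ᵥ a j)) •
    vecMulVec (tensorVec (a i) (a j)) (tensorVec (a i) (a j))

/-- Keep the signs on `I`, and replace those off `I` by `+`. -/
def maskSigns (I : Fin m → Bool) (e : Fin m → Bool) : Fin m → Bool :=
  fun i => if I i then e i else true

lemma sgn_true : sgn true = 1 := if_pos rfl

/-- On a cut pair only `i` carries a random sign, so the product of two signs becomes linear in `e`.
-/
lemma cutIndicator_mul_sgn_left (I e : Fin m → Bool) (i j : Fin m) :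
    cutIndicator I i j * (sgn (maskSigns I e i) * sgn (maskSigns I e j)) =
      sgn (e i) * cutIndicator I i j := by
  unfold cutIndicator maskSigns
  cases I i <;> cases I j <;> simp [sgn_true]

lemma cutIndicator_mul_sgn_right (I e : Fin m → Bool) (i j : Fin m) :
    cutIndicator I i j * (sgn (maskSigns (fun k => !I k) e i) *
      sgn (maskSigns (fun k => !I k) e j)) = sgn (e j) * cutIndicator I i j := by
  unfold cutIndicator maskSigns
  cases hi : I i <;> cases hj : I j <;> simp [hi, hj, sgn_true]

lemma tensorVec_smul_smul (u v : Fin n → ℝ) (c d : ℝ) :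
    tensorVec (c • u) (d • v) = (c * d) • tensorVec u v := by
  ext q; simp [tensorVec]; ring

lemma vecMulVec_tensorVec_flipRows (e : Fin m → Bool) (s : Fin m → Fin n → Bool) (i j : Fin m) :
    vecMulVec (tensorVec (component (flipRows e s) i) (component (flipRows e s) j))
      (tensorVec (component (flipRows e s) i) (component (flipRows e s) j)) =
    vecMulVec (tensorVec (component s i) (component s j))
      (tensorVec (component s i) (component s j)) := by
  rw [component_flipRows, component_flipRows, tensorVec_smul_smul, smul_vecMulVec,
    vecMulVec_smul, smul_smul, mul_mul_mul_comm, sgn_mul_self, sgn_mul_self, one_mul, one_smul]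

lemma component_flipRows_dotProduct (e : Fin m → Bool) (s : Fin m → Fin n → Bool) (i j : Fin m) :
    component (flipRows e s) i ⬝ᵥ component (flipRows e s) j =
      (sgn (e i) * sgn (e j)) * (component s i ⬝ᵥ component s j) := by
  rw [component_flipRows, component_flipRows, smul_dotProduct, dotProduct_smul, smul_smul,
    smul_eq_mul]

lemma cutMatrix_flipRows (I e : Fin m → Bool) (s : Fin m → Fin n → Bool) :
    cutMatrix I (component (flipRows (maskSigns I e) s)) =
      signedSum (cutBlock I (component s)) e := by
  simp only [cutMatrix, signedSum, cutBlock, vecMulVec_tensorVec_flipRows,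
    component_flipRows_dotProduct, ← mul_assoc _ (_ * _), cutIndicator_mul_sgn_left,
    Finset.smul_sum, smul_smul]
  simp only [mul_assoc]

lemma innerSum_flipRows (I e : Fin m → Bool) (i : Fin m) (s : Fin m → Fin n → Bool) :
    innerSum I i (component (flipRows (maskSigns (fun k => !I k) e) s)) =
      signedSum (fun j => (cutIndicator I i j * (component s i ⬝ᵥ component s j)) •
        vecMulVec (component s j) (component s j)) e := by
  simp only [innerSum, signedSum, vecMulVec_component_flipRows,
    component_flipRows_dotProduct, ← mul_assoc _ (_ * _), cutIndicator_mul_sgn_right,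
    smul_smul]
  simp only [mul_assoc]

lemma mulVec_dotProduct_self_le {d : Type*} [Fintype d] [DecidableEq d] (A : Matrix d d ℝ)
    (x : d → ℝ) : (A *ᵥ x) ⬝ᵥ (A *ᵥ x) ≤ ‖A‖ ^ 2 * (x ⬝ᵥ x) := by
  have h2 := l2_opNorm_mulVec A (WithLp.toLp 2 x)
  have h3 : ∀ y : d → ℝ, ‖WithLp.toLp 2 y‖ ^ 2 = y ⬝ᵥ y := by
    intro y
    rw [← real_inner_self_eq_norm_sq, EuclideanSpace.inner_toLp_toLp]; simp
  rw [← h3, ← h3, ← mul_pow]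
  exact pow_le_pow_left₀ (norm_nonneg _) h2 2

/-- The block is `aᵢaᵢᵀ ⊗ innerSum`: it contracts the first tensor factor of `x` with `aᵢ` and acts
by the inner sum on the second. -/
lemma cutBlock_mulVec (I : Fin m → Bool) (a : Fin m → Fin n → ℝ) (i : Fin m)
    (x : Fin n × Fin n → ℝ) :
    cutBlock I a i *ᵥ x = tensorVec (a i) (innerSum I i a *ᵥ fun l => a i ⬝ᵥ fun k => x (k, l)) := by
  have h : ∀ j, tensorVec (a i) (a j) ⬝ᵥ x = a j ⬝ᵥ fun l => a i ⬝ᵥ fun k => x (k, l) := by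
    intro j
    simp only [dotProduct, tensorVec, Fintype.sum_prod_type, Finset.mul_sum]
    rw [Finset.sum_comm]
    exact Finset.sum_congr rfl fun l _ => Finset.sum_congr rfl fun k _ => by ring
  ext q
  simp only [cutBlock, innerSum, sum_mulVec, smul_mulVec, vecMulVec_mulVec, h, Finset.sum_apply,
    tensorVec, Pi.smul_apply, smul_eq_mul, MulOpposite.smul_eq_mul_unop, MulOpposite.unop_op,
    Finset.mul_sum]
  exact Finset.sum_congr rfl fun j _ => by ring

lemma sum_cutBlock_mulVec_le [NeZero n] (I : Fin m → Bool) (s : Fin m → Fin n → Bool) {b : ℝ}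
    (hb : ∀ i, ‖innerSum I i (component s)‖ ^ 2 ≤ b) (hb0 : 0 ≤ b) (x : Fin n × Fin n → ℝ) :
    ∑ i, (cutBlock I (component s) i *ᵥ x) ⬝ᵥ (cutBlock I (component s) i *ᵥ x) ≤
      b * ‖outerSum (component s)‖ * (x ⬝ᵥ x) := by
  set a := component s with ha
  calc ∑ i, (cutBlock I a i *ᵥ x) ⬝ᵥ (cutBlock I a i *ᵥ x)
      ≤ ∑ i, b * ∑ l, (a i ⬝ᵥ fun k => x (k, l)) ^ 2 := by
        refine Finset.sum_le_sum fun i _ => ?_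
        rw [cutBlock_mulVec, tensorVec_dotProduct_tensorVec, ha, component_dotProduct_self,
          one_mul, ← ha]
        have h0 : (fun l => a i ⬝ᵥ fun k => x (k, l)) ⬝ᵥ (fun l => a i ⬝ᵥ fun k => x (k, l)) =
            ∑ l, (a i ⬝ᵥ fun k => x (k, l)) ^ 2 := by
          rw [dotProduct]; exact Finset.sum_congr rfl fun l _ => (sq _).symm
        refine (mulVec_dotProduct_self_le _ _).trans ?_
        rw [h0]
        exact mul_le_mul_of_nonneg_right (hb i) (Finset.sum_nonneg fun l _ => sq_nonneg _)
    _ = b * ∑ l, ∑ i, (a i ⬝ᵥ fun k => x (k, l)) ^ 2 := by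
        rw [← Finset.mul_sum, Finset.sum_comm]
    _ ≤ b * ∑ l, ‖outerSum a‖ * ((fun k => x (k, l)) ⬝ᵥ fun k => x (k, l)) := by
        gcongr with l
        exact sum_dotProduct_sq_le a _
    _ = _ := by
        rw [← Finset.mul_sum, ← mul_assoc]
        congr 1
        simp only [dotProduct, Fintype.sum_prod_type]
        exact Finset.sum_comm

lemma cutBlock_isHermitian (I : Fin m → Bool) (a : Fin m → Fin n → ℝ) (i : Fin m) :
    (cutBlock I a i).IsHermitian := by
  simp only [IsHermitian, cutBlock, conjTranspose_sum, conjTranspose_smul, star_trivial]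
  exact Finset.sum_congr rfl fun j _ => by rw [vecMulVec_self_isHermitian]

/-- The maximum over `i` in the variance is replaced by a sum, so that expectations can later be
taken term by term; this costs only a factor `m`. -/
lemma expect_norm_cutMatrix_flipRows_le [NeZero n] [NeZero m] (I : Fin m → Bool)
    (s : Fin m → Fin n → Bool) {p : ℕ} (hp : p ≠ 0) :
    𝔼 e, ‖cutMatrix I (component (flipRows (maskSigns I e) s))‖ ^ (2 * p) ≤
      (2 * p) ^ p * n ^ 2 *
        ∑ i, ‖outerSum (component s)‖ ^ p * ‖innerSum I i (component s)‖ ^ (2 * p) := by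
  obtain ⟨i, hi⟩ := Finite.exists_max (fun i => ‖innerSum I i (component s)‖)
  have key := expect_norm_signedSum_pow_le (cutBlock_isHermitian I (component s))
    (by positivity) (sum_cutBlock_mulVec_le I s (b := ‖innerSum I i (component s)‖ ^ 2)
      (fun j => pow_le_pow_left₀ (norm_nonneg _) (hi j) 2) (by positivity)) hp
  simp only [cutMatrix_flipRows]
  refine key.trans ?_
  have h1 : ‖outerSum (component s)‖ ^ p * ‖innerSum I i (component s)‖ ^ (2 * p) ≤
      ∑ i, ‖outerSum (component s)‖ ^ p * ‖innerSum I i (component s)‖ ^ (2 * p) :=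
    Finset.single_le_sum
      (f := fun i => ‖outerSum (component s)‖ ^ p * ‖innerSum I i (component s)‖ ^ (2 * p))
      (fun j _ => by positivity) (Finset.mem_univ i)
  calc _ = (2 * p) ^ p * n ^ 2 *
        (‖outerSum (component s)‖ ^ p * ‖innerSum I i (component s)‖ ^ (2 * p)) := by
        simp only [Fintype.card_prod, Fintype.card_fin, Nat.cast_mul, mul_pow, ← pow_mul]; ring
    _ ≤ _ := by gcongr

lemma expect_norm_innerSum_flipRows_le [NeZero n] (I : Fin m → Bool) (i : Fin m)
    (s : Fin m → Fin n → Bool) {p : ℕ} (hp : p ≠ 0) :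
    𝔼 e, ‖innerSum I i (component (flipRows (maskSigns (fun k => !I k) e) s))‖ ^ (2 * p) ≤
      (2 * p) ^ p * n * (coherence (component s) ^ (2 * p) * ‖outerSum (component s)‖ ^ p) := by
  set a := component s with ha
  have ho : 0 ≤ ‖outerSum a‖ := norm_nonneg _
  have hA : ∀ j, ((cutIndicator I i j * (a i ⬝ᵥ a j)) • vecMulVec (a j) (a j)).IsHermitian := by
    intro j
    rw [IsHermitian, conjTranspose_smul, star_trivial, vecMulVec_self_isHermitian]
  have hv : ∀ x : Fin n → ℝ,
      ∑ j, (((cutIndicator I i j * (a i ⬝ᵥ a j)) • vecMulVec (a j) (a j)) *ᵥ x) ⬝ᵥ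
        (((cutIndicator I i j * (a i ⬝ᵥ a j)) • vecMulVec (a j) (a j)) *ᵥ x) ≤
      coherence a ^ 2 * ‖outerSum a‖ * (x ⬝ᵥ x) := by
    intro x
    calc _ ≤ ∑ j, coherence a ^ 2 * (a j ⬝ᵥ x) ^ 2 := by
          refine Finset.sum_le_sum fun j _ => ?_
          have hc : (cutIndicator I i j * (a i ⬝ᵥ a j)) ^ 2 ≤ coherence a ^ 2 := by
            by_cases hij : i = j
            · subst hij; rw [cutIndicator_self, zero_mul, zero_pow two_ne_zero]; exact sq_nonneg _
            · unfold cutIndicator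
              split_ifs
              · rw [one_mul]; exact dotProduct_sq_le_coherence_sq a hij
              · rw [zero_mul, zero_pow two_ne_zero]; exact sq_nonneg _
          have hj : a j ⬝ᵥ a j = 1 := component_dotProduct_self s j
          refine le_trans (le_of_eq ?_) (mul_le_mul_of_nonneg_right hc (sq_nonneg (a j ⬝ᵥ x)))
          rw [smul_mulVec, vecMulVec_mulVec]
          simp only [smul_dotProduct, dotProduct_smul, hj, smul_eq_mul,
            MulOpposite.smul_eq_mul_unop, MulOpposite.unop_op]
          ring
      _ = coherence a ^ 2 * ∑ j, (a j ⬝ᵥ x) ^ 2 := by rw [Finset.mul_sum]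
      _ ≤ _ := by
          rw [mul_assoc]
          exact mul_le_mul_of_nonneg_left (sum_dotProduct_sq_le a x) (sq_nonneg _)
  have key := expect_norm_signedSum_pow_le hA (by positivity) hv hp
  simp only [innerSum_flipRows]
  refine key.trans (le_of_eq ?_)
  rw [Fintype.card_fin, mul_pow (2 * (p : ℝ)), mul_pow _ ‖outerSum a‖, ← pow_mul]
  ring

/-- The two rounds of signs compose because `outerSum` is invariant under row signs and so factors
out of the second average. -/
lemma expect_norm_cutMatrix_le [NeZero n] [NeZero m] (I : Fin m → Bool) {p : ℕ} (hp : p ≠ 0) :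
    𝔼 s : Fin m → Fin n → Bool, ‖cutMatrix I (component s)‖ ^ (2 * p) ≤
      (2 * p) ^ (2 * p) * n ^ 3 * m *
        𝔼 s : Fin m → Fin n → Bool,
          coherence (component s) ^ (2 * p) * ‖outerSum (component s)‖ ^ (2 * p) := by
  have h1 : ∀ i, 𝔼 s : Fin m → Fin n → Bool,
      ‖outerSum (component s)‖ ^ p * ‖innerSum I i (component s)‖ ^ (2 * p) ≤
      (2 * p) ^ p * n * 𝔼 s : Fin m → Fin n → Bool,
          coherence (component s) ^ (2 * p) * ‖outerSum (component s)‖ ^ (2 * p) := by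
    intro i
    rw [← expect_expect_involutive (fun e => flipRows_involutive (maskSigns (fun k => !I k) e)),
      Finset.mul_expect]
    refine Finset.expect_le_expect fun s _ => ?_
    simp only [outerSum_flipRows]
    rw [← Finset.mul_expect]
    calc _ ≤ ‖outerSum (component s)‖ ^ p * ((2 * p) ^ p * n *
          (coherence (component s) ^ (2 * p) * ‖outerSum (component s)‖ ^ p)) :=
          mul_le_mul_of_nonneg_left (expect_norm_innerSum_flipRows_le I i s hp) (by positivity)
      _ = _ := by ring
  rw [← expect_expect_involutive (fun e => flipRows_involutive (maskSigns I e))]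
  calc _ ≤ 𝔼 s : Fin m → Fin n → Bool, (2 * p) ^ p * n ^ 2 *
        ∑ i, ‖outerSum (component s)‖ ^ p * ‖innerSum I i (component s)‖ ^ (2 * p) :=
        Finset.expect_le_expect fun s _ => expect_norm_cutMatrix_flipRows_le I s hp
    _ = (2 * p) ^ p * n ^ 2 * ∑ i, 𝔼 s : Fin m → Fin n → Bool,
          ‖outerSum (component s)‖ ^ p * ‖innerSum I i (component s)‖ ^ (2 * p) := by
        rw [← Finset.mul_expect, Finset.expect_sum_comm]
    _ ≤ (2 * p) ^ p * n ^ 2 * ∑ _i : Fin m, (2 * p) ^ p * n * 𝔼 s : Fin m → Fin n → Bool,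
          coherence (component s) ^ (2 * p) * ‖outerSum (component s)‖ ^ (2 * p) := by
        gcongr with i
        exact h1 i
    _ = _ := by
        rw [Finset.sum_const, Finset.card_univ, Fintype.card_fin, nsmul_eq_mul]; ring

lemma expect_coherence_mul_norm_outerSum_le [NeZero n] (hnm : n ≤ m) {p : ℕ} (hp : p ≠ 0) :
    𝔼 s : Fin m → Fin n → Bool,
        coherence (component s) ^ (2 * p) * ‖outerSum (component s)‖ ^ (2 * p) ≤
      (4 * p * (1 / n : ℝ)) ^ p * (8 * p * (m / n : ℝ)) ^ (2 * p) * ((m ^ 2 + n + m) / 2) := by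
  have hn : (0 : ℝ) < n := Nat.cast_pos.2 (NeZero.pos n)
  have hm : (0 : ℝ) < m := hn.trans_le (by exact_mod_cast hnm)
  have hp0 : (0 : ℝ) < p := by exact_mod_cast Nat.pos_of_ne_zero hp
  set u : ℝ := (4 * p * (1 / n : ℝ)) ^ p with hu
  set v : ℝ := (8 * p * (m / n : ℝ)) ^ (2 * p) with hv
  have hu0 : 0 < u := by positivity
  have hv0 : 0 < v := by positivity
  have h1 := expect_coherence_pow_le (m := m) (n := n) (p := 2 * p) (by omega)
  have h2 := expect_norm_outerSum_pow_le hnm (p := 2 * p) (by omega)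
  have h1' : 𝔼 s : Fin m → Fin n → Bool, (coherence (component s) ^ (2 * p)) ^ 2 ≤
      m ^ 2 * u ^ 2 := by
    refine le_trans (le_of_eq ?_) (h1.trans (le_of_eq ?_))
    · exact Finset.expect_congr rfl fun s _ => by ring
    · rw [hu]; push_cast; ring
  have h2' : 𝔼 s : Fin m → Fin n → Bool, (‖outerSum (component s)‖ ^ (2 * p)) ^ 2 ≤
      v ^ 2 * (n + m) := by
    refine le_trans (le_of_eq ?_) (h2.trans (le_of_eq ?_))
    · exact Finset.expect_congr rfl fun s _ => by ring
    · rw [hv]; push_cast; ring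
  -- Coherence and `outerSum` are dependent; weighted AM-GM, balanced by the expected sizes `u` and
  -- `v`, separates them at the cost of doubling the moment order.
  have h3 : ∀ x y : ℝ, x * y ≤ v / (2 * u) * x ^ 2 + u / (2 * v) * y ^ 2 := by
    intro x y
    have : v / (2 * u) * x ^ 2 + u / (2 * v) * y ^ 2 - x * y =
        (v * x - u * y) ^ 2 / (2 * u * v) := by field_simp; ring
    have h4 : 0 ≤ (v * x - u * y) ^ 2 / (2 * u * v) := by positivity
    linarith
  calc _ ≤ 𝔼 s : Fin m → Fin n → Bool, (v / (2 * u) * (coherence (component s) ^ (2 * p)) ^ 2 +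
        u / (2 * v) * (‖outerSum (component s)‖ ^ (2 * p)) ^ 2) :=
        Finset.expect_le_expect fun s _ => h3 _ _
    _ ≤ v / (2 * u) * (m ^ 2 * u ^ 2) + u / (2 * v) * (v ^ 2 * (n + m)) := by
        rw [Finset.expect_add_distrib, ← Finset.mul_expect, ← Finset.mul_expect]
        gcongr
    _ = _ := by field_simp; ring

/-- Moment bound for the spectral norm of the cross matrix. -/
theorem expect_norm_crossMatrix_pow_le [NeZero n] (hnm : n ≤ m) {p : ℕ} (hp : p ≠ 0) :
    𝔼 s : Fin m → Fin n → Bool, ‖crossMatrix (component s)‖ ^ (2 * p) ≤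
      n ^ 3 * m * ((m ^ 2 + n + m) / 2) * (16384 * p ^ 5 * (m ^ 2 / n ^ 3 : ℝ)) ^ p := by
  have : NeZero m := ⟨by have := NeZero.pos n; omega⟩
  calc _ ≤ 𝔼 s : Fin m → Fin n → Bool,
          16 ^ p * 𝔼 I : Fin m → Bool, ‖cutMatrix I (component s)‖ ^ (2 * p) :=
        Finset.expect_le_expect fun s _ => norm_crossMatrix_pow_le _ p
    _ = 16 ^ p * 𝔼 I : Fin m → Bool, 𝔼 s : Fin m → Fin n → Bool,
          ‖cutMatrix I (component s)‖ ^ (2 * p) := by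
        rw [← Finset.mul_expect, Finset.expect_comm]
    _ ≤ 16 ^ p * ((2 * p) ^ (2 * p) * n ^ 3 * m * ((4 * p * (1 / n : ℝ)) ^ p *
          (8 * p * (m / n : ℝ)) ^ (2 * p) * ((m ^ 2 + n + m) / 2))) := by
        gcongr
        refine Finset.expect_le Finset.univ_nonempty fun I _ => ?_
        refine (expect_norm_cutMatrix_le I hp).trans ?_
        gcongr
        exact expect_coherence_mul_norm_outerSum_le hnm hp
    _ = n ^ 3 * m * ((m ^ 2 + n + m) / 2) * (16 * (2 * p) ^ 2 * (4 * p * (1 / n : ℝ)) *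
          (8 * p * (m / n : ℝ)) ^ 2) ^ p := by
        simp only [mul_pow, ← pow_mul]; ring
    _ = _ := by
        congr 2; ring

end Decoupling

/-! ### Markov's inequality and the choice of the moment order -/

section Tail

variable {m n : ℕ}

/-- Markov's inequality for the uniform distribution on sign arrays. -/
lemma one_sub_le_signMeasure_real {F : (Fin m → Fin n → Bool) → ℝ} (hF : ∀ s, 0 ≤ F s)
    {T δ : ℝ} (hT : 0 < T) (h : 𝔼 s, F s ≤ δ * T) :
    1 - δ ≤ (signMeasure m n).real {s | F s ≤ T} := by
  classical
  have hreal : (signMeasure m n).real {s | F s ≤ T} = 𝔼 s, if F s ≤ T then (1 : ℝ) else 0 := by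
    rw [MeasureTheory.measureReal_def, signMeasure,
      PMF.toMeasure_uniformOfFintype_apply _ (Set.toFinite _).measurableSet,
      Fintype.expect_eq_sum_div_card, ENNReal.toReal_div]
    simp [Fintype.card_subtype]
  have h1 : 𝔼 s, (1 - F s / T) ≤ 𝔼 s, if F s ≤ T then (1 : ℝ) else 0 := by
    refine Finset.expect_le_expect fun s _ => ?_
    split_ifs with hs
    · have := div_nonneg (hF s) hT.le
      linarith
    · have := (one_le_div hT).2 (not_le.1 hs).le
      linarith
  rw [Finset.expect_sub_distrib, Fintype.expect_const, ← Finset.expect_div] at h1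
  have h2 : (𝔼 s, F s) / T ≤ δ := (div_le_iff₀ hT).2 h
  rw [hreal]
  linarith

lemma polynomial_prefactor_le {x y : ℝ} (hx : 2 ≤ x) (hxy : x ≤ y) (hy : y ^ 2 ≤ x ^ 3) :
    x ^ 3 * y * ((y ^ 2 + x + y) / 2) ≤ x ^ 9 := by
  have hy0 : 0 ≤ y := by linarith
  have h1 : y ≤ x ^ 2 := by
    refine le_of_sq_le_sq ?_ (by positivity)
    calc y ^ 2 ≤ x ^ 3 := hy
      _ ≤ x * x ^ 3 := le_mul_of_one_le_left (by positivity) (by linarith)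
      _ = _ := by ring
  have h2 : (y ^ 2 + x + y) / 2 ≤ x * x ^ 3 := by nlinarith
  calc x ^ 3 * y * ((y ^ 2 + x + y) / 2) ≤ x ^ 3 * x ^ 2 * (x * x ^ 3) := by
        have : 0 ≤ (y ^ 2 + x + y) / 2 := by positivity
        gcongr
    _ = x ^ 9 := by ring

/-- Since `p ≤ 2L`, the left base is at most `16384 · 2⁵ · L⁵ R² = 524288 L⁵ R²`. The spare power of
`L` in `L⁶` pays for this constant and for a factor `e^{-(D+9)}`, which is then raised to a power `p
≥ L`. -/
lemma moment_factor_le {L R : ℝ} {p D : ℕ} (hL : 524288 * Real.exp (D + 9) ≤ L) (hLp : L ≤ p)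
    (hp : (p : ℝ) ≤ 2 * L) :
    (16384 * (p : ℝ) ^ 5 * R ^ 2) ^ p ≤ Real.exp (-((D + 9) * L)) * (L ^ 3 * R) ^ (2 * p) := by
  have hL0 : 0 < L := lt_of_lt_of_le (by positivity) hL
  have h1 : 16384 * (p : ℝ) ^ 5 ≤ Real.exp (-(D + 9)) * L ^ 6 := by
    calc 16384 * (p : ℝ) ^ 5 ≤ 16384 * (2 * L) ^ 5 := by gcongr
      _ = Real.exp (-(D + 9)) * (524288 * Real.exp (D + 9)) * L ^ 5 := by
          rw [mul_left_comm, ← Real.exp_add]; simp; ring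
      _ ≤ Real.exp (-(D + 9)) * L * L ^ 5 := by gcongr
      _ = _ := by ring
  calc (16384 * (p : ℝ) ^ 5 * R ^ 2) ^ p ≤ (Real.exp (-(D + 9)) * L ^ 6 * R ^ 2) ^ p := by gcongr
    _ = Real.exp (-(D + 9)) ^ p * (L ^ 3 * R) ^ (2 * p) := by
        rw [pow_mul, ← mul_pow]; congr 1; ring
    _ ≤ _ := by
        have : (0 : ℝ) ≤ (L ^ 3 * R) ^ (2 * p) := (even_two_mul p).pow_nonneg _
        gcongr
        rw [← Real.exp_nat_mul]
        refine Real.exp_le_exp.2 ?_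
        have : (D + 9 : ℝ) * L ≤ (D + 9) * p := by gcongr
        linarith

end Tail

theorem mainTheorem4 :
    ∃ (C : ℝ) (k : ℕ), 0 < C ∧ ∀ D : ℕ, ∃ N : ℕ, ∀ n m : ℕ,
      N ≤ n → n ≤ m → (m : ℝ) ≤ (n : ℝ) ^ (3 / 2 : ℝ) →
        1 - 1 / (n : ℝ) ^ D ≤
          (signMeasure m n).real
            {s | matrixSpectralNorm (crossMatrix (component s)) ≤
                    C * Real.log n ^ k * ((m : ℝ) / (n : ℝ) ^ (3 / 2 : ℝ)) ∧
                 SosLE ![sphereConstraint n] 4 (crossPolynomial (component s))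
                    (MvPolynomial.C
                      (C * Real.log n ^ k * ((m : ℝ) / (n : ℝ) ^ (3 / 2 : ℝ))))} := by
  -- The moments give `(log n)^{5/2}`; rounding the exponent up to `3` leaves a half power that
  -- absorbs all constants, so `C = 1` and only `N` depends on `D`.
  refine ⟨1, 3, one_pos, fun D => ⟨max 2 ⌈Real.exp (524288 * Real.exp (D + 9))⌉₊,
    fun n m hN hnm hm => ?_⟩⟩
  have hn2 : 2 ≤ n := (le_max_left _ _).trans hN
  have hn2' : (2 : ℝ) ≤ n := by exact_mod_cast hn2
  have : NeZero n := ⟨by omega⟩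
  have hn0 : (0 : ℝ) < n := by linarith
  have hnm' : (n : ℝ) ≤ m := by exact_mod_cast hnm
  have hm0 : (0 : ℝ) < m := by linarith
  set L := Real.log n with hLdef
  have hL : 524288 * Real.exp (D + 9) ≤ L := by
    rw [hLdef, Real.le_log_iff_exp_le hn0]
    exact (Nat.le_ceil _).trans (by exact_mod_cast (le_max_right _ _).trans hN)
  have hL1 : 1 ≤ L := by
    have := Real.one_le_exp (x := (D + 9 : ℝ)) (by positivity)
    linarith
  set Q : ℝ := (n : ℝ) ^ (3 / 2 : ℝ) with hQ
  have hQ0 : 0 < Q := by positivity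
  have hQ2 : Q ^ 2 = (n : ℝ) ^ 3 := by
    rw [hQ, ← Real.rpow_natCast, ← Real.rpow_mul hn0.le, ← Real.rpow_natCast]; norm_num
  set R : ℝ := m / Q with hR
  have hR2 : (m : ℝ) ^ 2 / n ^ 3 = R ^ 2 := by rw [hR, div_pow, hQ2]
  set B : ℝ := 1 * L ^ 3 * R with hB
  have hB0 : 0 < B := by positivity
  set p := ⌈L⌉₊ with hp
  have hp0 : p ≠ 0 := (Nat.ceil_pos.2 (by linarith)).ne'
  have hLp : L ≤ p := Nat.le_ceil L
  have hp2 : (p : ℝ) ≤ 2 * L := by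
    have := Nat.ceil_lt_add_one (show 0 ≤ L by linarith)
    linarith
  have hmom : 𝔼 s : Fin m → Fin n → Bool, ‖crossMatrix (component s)‖ ^ (2 * p) ≤
      1 / (n : ℝ) ^ D * B ^ (2 * p) := by
    -- The extra `n⁻⁹` cancels the polynomial prefactor, whose bound is where `m ≤ n^{3/2}` enters.
    have hexp : Real.exp (-((D + 9) * L)) = 1 / ((n : ℝ) ^ D * n ^ 9) := by
      rw [Real.exp_neg, ← pow_add, one_div, mul_comm, Real.exp_mul, hLdef, Real.exp_log hn0]
      norm_cast
    calc _ ≤ n ^ 3 * m * ((m ^ 2 + n + m) / 2) * (16384 * p ^ 5 * (m ^ 2 / n ^ 3 : ℝ)) ^ p :=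
          expect_norm_crossMatrix_pow_le hnm hp0
      _ ≤ n ^ 9 * (Real.exp (-((D + 9) * L)) * (L ^ 3 * R) ^ (2 * p)) := by
          have h1 := polynomial_prefactor_le hn2' hnm' (by rw [← hQ2]; gcongr)
          rw [hR2]
          gcongr
          exact moment_factor_le hL hLp hp2
      _ = _ := by
          rw [hexp, hB, one_mul]; field_simp
  refine (one_sub_le_signMeasure_real (fun s => by positivity) (by positivity) hmom).trans ?_
  have : MeasureTheory.IsProbabilityMeasure (signMeasure m n) := by
    unfold signMeasure; infer_instance
  refine MeasureTheory.measureReal_mono fun s hs => ?_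
  have hs' : ‖crossMatrix (component s)‖ ≤ B :=
    le_of_pow_le_pow_left₀ (by positivity) hB0.le hs
  -- The scoped operator norm agrees definitionally with `matrixSpectralNorm`; the certificate needs
  -- no further randomness.
  exact ⟨hs', sosLE_crossPolynomial _ hs'⟩
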